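/- Let $\mathcal H$ be a finite-dimensional real Hilbert space and $S\subseteq\mathcal H$ nonempty, closed and convex. **Notions.** For $h:\mathcal H\to[-\infty,+\infty]$ put $\operatorname{dom}h=\{h<+\infty\}$; $h$ is proper if $\operatorname{dom}h\ne\varnothing$ and $h>-\infty$ everywhere. $\iota_A$ is $0$ on $A$ and $+\infty$ off $A$, and $h+\iota_A$ is $+\infty$ off $A$. If $h$ is finite at $x$, the Fréchet subdifferential is $$\widehat\partial h(x)=\Big\{u:\ \liminf_{z\to x,\,z\neq x}\tfrac{h(z)-h(x)-\langle u,z-x\rangle}{\|z-x\|}\ge 0\Big\},$$ and the limiting subdifferential $\partial_L h(x)$ is the set of all $u=\lim u_k$ with $u_k\in\widehat\partial h(x_k)$, $x_k\to x$, $h(x_k)\to h(x)$; both are empty where $h$ is not finite. $h$ is regular at $x$ if $h$ is finite at $x$ and $\widehat\partial h(x)=\partial_Lh(x)$; a set $A$ is regular at $x\in A$ if $\iota_A$ is. $h$ is weakly convex on $A$ with constant $\beta\ge0$ if $h+\iota_A+\frac{\beta}{2}\|\cdot\|^2$ is convex. $h$ is strictly differentiable at $x$ if it is finite around $x$ and there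 is $u\in\mathcal H$ with $\lim_{y,z\to x,\,y\neq z}\frac{h(y)-h(z)-\langle u,y-z\rangle}{\|y-z\|}=0$. Lower semicontinuity is meant at every point of $\mathcal H$. **Assumption 1.** $f=f^{s}+f^{n}$, where $f^{s}:\mathcal H\to\mathbb R$ is convex and continuously differentiable, $\nabla f^{s}$ is Lipschitz with constant $\ell\ge 0$, $f^{n}:\mathcal H\to(-\infty,+\infty]$ is proper and lower semicontinuous, $S\cap\operatorname{dom}f\neq\varnothing$, and $f\ge0$ on $S\cap\operatorname{dom}f$. **Assumption 2.** $g:\mathcal H\to(-\infty,+\infty]$ is proper and lower semicontinuous, finite and positive on $S$, continuous on an open set containing $S$, and either weakly convex with constant $\beta\ge 0$ on an open convex set containing $S$, or regular at every point of $S$ and weakly convex with constant $\beta\ge 0$ on $S$. **Assumption 3.** $f^{n}=f^{l}+\iota_C$, where $C\subseteq\mathcal H$ is nonempty and closed, $C\cap S\neq\varnothing$, and one of the following holds: (a) $f^{l}$ is (finite and) locally Lipschitz on $\mathcal H$ and $C=S=\mathcal H$; (b) $f^{l}$ is (finite and) locally Lipschitz on an open set containing $S\cap\operatorname{dom}f$,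 both $f^{l}$ and $C\cap S$ are regular at every point of $S\cap\operatorname{dom}f$, and $g$ is positive on an open set containing $S\cap\operatorname{dom}f$; (c) $f^{l}$ is strictly differentiable at every point of an open set containing $S\cap\operatorname{dom}f$, and $g$ is positive on an open set containing $S\cap\operatorname{dom}f$. **Algorithm (e-PSG).** Let $\delta,\zeta>0$ with $1-\sqrt\beta\,\zeta>0$. Consider the condition (BC) $\quad m\le g(x)\le M$ for all $x\in S\cap\operatorname{dom}f$, with constants $m,M>0$. If (BC) holds, for such $m,M$ choose $$\overline\mu\in\Big[0,\tfrac{\delta(1-\sqrt\beta\zeta)\sqrt{mM}}{2M}\Big),\qquad \overline\kappa\in\Big[0,\sqrt{\tfrac{m\delta(1-\sqrt\beta\zeta)}{\ell M}-\tfrac{2m\overline\mu}{\ell\sqrt{mM}}}\Big)$$ (the upper bound on $\overline\kappa$ being $+\infty$ if $\ell=0$); otherwise put $\overline\mu=\overline\kappa=0$. Let $x_{-1}=x_0\in S\cap\operatorname{dom}f$. For $n=0,1,2,\dots$ let $\theta_n=f(x_n)/g(x_n)$, choose $g_n\in\partial_Lg(x_n)$, $\tau_n$ with $0<\tau_n\le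 1/\max\{\sqrt\beta\,\theta_n/\zeta,\delta\}$, $\kappa_n\in[0,\overline\kappa]$, $\mu_n\in[0,\overline\mu\tau_n]$, put $u_n=x_n+\kappa_n(x_n-x_{n-1})$, $v_n=x_n+\mu_n(x_n-x_{n-1})$, and let $$x_{n+1}\in\operatorname*{argmin}_{x\in S}\Big(f^{n}(x)+f^{s}(u_n)+\langle\nabla f^{s}(u_n),x-u_n\rangle+\tfrac1{2\tau_n}\|x-v_n-\tau_n\theta_ng_n\|^2+\tfrac{\ell}{2}\|x-u_n\|^2\Big).$$ **Corollary.** Let $(x_n)_{n\in\mathbb N}$ be an (infinite) sequence generated by this algorithm. Suppose that Assumptions 1, 2 and 3 hold, that $\{x\in S:\ f(x)/g(x)\le f(x_0)/g(x_0)\}$ is bounded, that $\liminf_{n\to\infty}\tau_n>0$, and that $g$ is strictly differentiable at every point of an open set containing $S\cap\operatorname{dom}f$. Then every cluster point $\overline x$ of $(x_n)$ is a (limiting) stationary point of $\min_{x\in S}f(x)/g(x)$, that is, $\overline x\in S$ and $$0\in\partial_L\Big(\frac fg+\iota_S\Big)(\overline x).$$ -/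

import Mathlib

open Filter Topology Set
open scoped NNReal

noncomputable section

namespace FracProg

/-! Extended real-valued functions, `h : H → EReal`. -/

section Basic

variable {H : Type*}

/-- The domain `{x | h x < +∞}`. -/
def edom (h : H → EReal) : Set H := {x | h x < ⊤}

/-- `h` is proper: its domain is nonempty and it never takes the value `-∞`. -/
def Proper (h : H → EReal) : Prop := (edom h).Nonempty ∧ ∀ x, h x ≠ ⊥

/-- `h` is finite at `x`. -/
def FiniteAt (h : H → EReal) (x : H) : Prop := h x ≠ ⊥ ∧ h x ≠ ⊤

open Classical in
/-- The indicator function `ι_S` of a set. -/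
def indicatorFn (S : Set H) (x : H) : EReal := if x ∈ S then 0 else ⊤

open Classical in
/-- The function `h + ι_S`: equal to `h` on `S` and to `+∞` off `S`, whatever `h` is there. -/
def addIndicator (h : H → EReal) (S : Set H) (x : H) : EReal := if x ∈ S then h x else ⊤

/-- Where `h` does not take the value `-∞`, `addIndicator` is the sum `h + ι_S` in `EReal`. -/
theorem addIndicator_eq_add {h : H → EReal} {S : Set H} {x : H} (hx : h x ≠ ⊥) :
    addIndicator h S x = h x + indicatorFn S x := by
  unfold addIndicator indicatorFn
  split_ifs
  · simp
  · exact (EReal.add_top_of_ne_bot hx).symm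

end Basic

variable {H : Type*} [NormedAddCommGroup H] [InnerProductSpace ℝ H]

/-- The Fréchet subdifferential of `h` at `x`; empty where `h` is not finite. -/
def frechetSubdiff (h : H → EReal) (x : H) : Set H :=
  {u | FiniteAt h x ∧
    0 ≤ liminf (fun z : H =>
      (h z - h x - ((inner ℝ u (z - x) : ℝ) : EReal)) / ((‖z - x‖ : ℝ) : EReal)) (𝓝[≠] x)}

/-- The limiting subdifferential of `h` at `x`; empty where `h` is not finite. -/
def limitingSubdiff (h : H → EReal) (x : H) : Set H :=
  {u | FiniteAt h x ∧ ∃ (xs us : ℕ → H),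
    Tendsto xs atTop (𝓝 x) ∧ Tendsto (fun n => h (xs n)) atTop (𝓝 (h x)) ∧
    Tendsto us atTop (𝓝 u) ∧ ∀ n, us n ∈ frechetSubdiff h (xs n)}

/-- `h` is (lower) regular at `x`. -/
def RegularAt (h : H → EReal) (x : H) : Prop :=
  FiniteAt h x ∧ frechetSubdiff h x = limitingSubdiff h x

/-- The set `A` is regular at `x ∈ A`: its Fréchet and limiting normal cones at `x`, that is, the
two subdifferentials of the indicator function, agree. -/
def SetRegularAt (A : Set H) (x : H) : Prop :=
  x ∈ A ∧ frechetSubdiff (indicatorFn A) x = limitingSubdiff (indicatorFn A) x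

/-- `h` is strictly differentiable at `x` (in particular, finite around `x`). -/
def StrictDiffAt (h : H → EReal) (x : H) : Prop :=
  (∀ᶠ y in 𝓝 x, FiniteAt h y) ∧
    ∃ L : H →L[ℝ] ℝ, HasStrictFDerivAt (fun y => (h y).toReal) L x

/-- `h` is finite and locally Lipschitz continuous on `U`. -/
def LocLipschitzOn (h : H → EReal) (U : Set H) : Prop :=
  (∀ x ∈ U, FiniteAt h x) ∧ LocallyLipschitzOn U (fun x => (h x).toReal)

/-- Convexity on `H` of a function with values in `(-∞, +∞]`. -/
def EConvex (h : H → EReal) : Prop :=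
  ∀ (x y : H) (a b : ℝ), 0 < a → 0 < b → a + b = 1 →
    h (a • x + b • y) ≤ (a : EReal) * h x + (b : EReal) * h y

/-- `h` is weakly convex on `A` with constant `β`: `h + ι_A + (β/2)‖·‖²` is convex. -/
def WeaklyConvexOn (h : H → EReal) (A : Set H) (β : ℝ) : Prop :=
  EConvex (addIndicator (fun x => h x + ((β / 2 * ‖x‖ ^ 2 : ℝ) : EReal)) A)

/-! The fractional program `min_{x ∈ S} f x / g x`. -/

/-- Assumptions on the numerator `f = fs + fn`. -/
structure NumeratorAssumption [CompleteSpace H] (f : H → EReal) (fs : H → ℝ) (fn : H → EReal)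
    (S : Set H) (ℓ : ℝ≥0) : Prop where
  decomp : ∀ x, f x = (fs x : EReal) + fn x
  smooth_convex : ConvexOn ℝ univ fs
  smooth_contDiff : ContDiff ℝ 1 fs
  smooth_lipschitz : LipschitzWith ℓ (gradient fs)
  fn_proper : Proper fn
  fn_lsc : LowerSemicontinuous fn
  feasible : (S ∩ edom f).Nonempty
  nonneg : ∀ x ∈ S ∩ edom f, 0 ≤ f x

/-- Assumptions on the denominator `g`. -/
structure DenominatorAssumption (g : H → EReal) (S : Set H) (β : ℝ) : Prop where
  proper : Proper g
  lsc : LowerSemicontinuous g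
  finite_pos : ∀ x ∈ S, 0 < g x ∧ g x < ⊤
  cont : ∃ O : Set H, IsOpen O ∧ S ⊆ O ∧ ContinuousOn g O
  modulus_nonneg : 0 ≤ β
  weaklyConvex :
    (∃ O : Set H, IsOpen O ∧ Convex ℝ O ∧ S ⊆ O ∧ WeaklyConvexOn g O β) ∨
      ((∀ x ∈ S, RegularAt g x) ∧ WeaklyConvexOn g S β)

/-- The boundedness condition `m ≤ g ≤ M` on `S ∩ dom f`, with `m, M > 0`. -/
def BoundCond (f g : H → EReal) (S : Set H) (m M : ℝ) : Prop :=
  0 < m ∧ 0 < M ∧ ∀ x ∈ S ∩ edom f, (m : EReal) ≤ g x ∧ g x ≤ (M : EReal)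

/-- Admissible parameters of the algorithm. When `ℓ = 0` the upper bound on `κbar`, which has `ℓ`
in the denominator, is read as `+∞`. The parameters `μbar = κbar = 0` need no boundedness
condition. -/
structure Parameters (f g : H → EReal) (S : Set H) (ℓ : ℝ≥0) (β δ ζ μbar κbar : ℝ) : Prop where
  δ_pos : 0 < δ
  ζ_pos : 0 < ζ
  ζ_small : 0 < 1 - √β * ζ
  bounds :
    (∃ m M : ℝ, BoundCond f g S m M ∧
      0 ≤ μbar ∧ μbar < δ * (1 - √β * ζ) * √(m * M) / (2 * M) ∧
      0 ≤ κbar ∧ (0 < ℓ →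
        κbar < √(m * δ * (1 - √β * ζ) / (ℓ * M) - 2 * m * μbar / (ℓ * √(m * M))))) ∨
    (μbar = 0 ∧ κbar = 0)

/-- The objective of the subproblem solved at each iteration. -/
def subproblem [CompleteSpace H] (fs : H → ℝ) (fn : H → EReal) (ℓ : ℝ≥0) (u v w : H) (θ τ : ℝ)
    (y : H) : EReal :=
  fn y + ((fs u + inner ℝ (gradient fs u) (y - u) + 1 / (2 * τ) * ‖y - v - (τ * θ) • w‖ ^ 2
    + ℓ / 2 * ‖y - u‖ ^ 2 : ℝ) : EReal)

/-- The value `θ = f x / g x` as a real number (used only where `f x` and `g x` are finite). -/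
def ratio (f g : H → EReal) (x : H) : ℝ := (f x / g x).toReal

/-- `x` is a sequence generated by the extrapolated proximal subgradient algorithm, where `w n` is
the chosen subgradient of `g` at `x n`, and `τ n`, `κ n`, `μ n` are the chosen step size and
extrapolation parameters. The convention `x₋₁ = x₀` is rendered by the truncated subtraction:
`x (n - 1)` is `x 0` for `n = 0`. -/
structure IsEPSG [CompleteSpace H] (f : H → EReal) (fs : H → ℝ) (fn g : H → EReal) (S : Set H)
    (ℓ : ℝ≥0) (β δ ζ μbar κbar : ℝ) (x w : ℕ → H) (τ κ μ : ℕ → ℝ) : Prop where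
  start : x 0 ∈ S ∩ edom f
  subgrad : ∀ n, w n ∈ limitingSubdiff g (x n)
  τ_pos : ∀ n, 0 < τ n
  τ_le : ∀ n, τ n ≤ 1 / max (√β * ratio f g (x n) / ζ) δ
  κ_mem : ∀ n, κ n ∈ Icc 0 κbar
  μ_mem : ∀ n, μ n ∈ Icc 0 (μbar * τ n)
  step_mem : ∀ n, x (n + 1) ∈ S
  step_argmin : ∀ n, ∀ y ∈ S,
    subproblem fs fn ℓ (x n + κ n • (x n - x (n - 1))) (x n + μ n • (x n - x (n - 1))) (w n)
        (ratio f g (x n)) (τ n) (x (n + 1)) ≤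
      subproblem fs fn ℓ (x n + κ n • (x n - x (n - 1))) (x n + μ n • (x n - x (n - 1))) (w n)
        (ratio f g (x n)) (τ n) y

/-- The additional assumption on the nonsmooth part, `fn = fl + ι_C`. -/
structure StructureAssumption (f fn fl g : H → EReal) (S C : Set H) : Prop where
  C_nonempty : C.Nonempty
  C_closed : IsClosed C
  inter_nonempty : (C ∩ S).Nonempty
  decomp : fn = addIndicator fl C
  alternatives :
    (LocLipschitzOn fl univ ∧ C = univ ∧ S = univ) ∨
    ((∃ U : Set H, IsOpen U ∧ S ∩ edom f ⊆ U ∧ LocLipschitzOn fl U) ∧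
      (∀ x ∈ S ∩ edom f, RegularAt fl x ∧ SetRegularAt (C ∩ S) x) ∧
      (∃ V : Set H, IsOpen V ∧ S ∩ edom f ⊆ V ∧ ∀ x ∈ V, 0 < g x)) ∨
    ((∃ U : Set H, IsOpen U ∧ S ∩ edom f ⊆ U ∧ ∀ x ∈ U, StrictDiffAt fl x) ∧
      (∃ V : Set H, IsOpen V ∧ S ∩ edom f ⊆ V ∧ ∀ x ∈ V, 0 < g x))

/-- `x` is a (limiting) stationary point: `x ∈ S` and `0 ∈ ∂_L (f/g + ι_S) x`. -/
def IsStationary (f g : H → EReal) (S : Set H) (x : H) : Prop :=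
  x ∈ S ∧ (0 : H) ∈ limitingSubdiff (addIndicator (fun y => f y / g y) S) x

end FracProg

end

open Filter Topology Set
open scoped NNReal

namespace FracProg

/-! ### Fréchet and limiting subgradients near points of strict differentiability. -/

section

variable {H : Type*} [NormedAddCommGroup H] [InnerProductSpace ℝ H]

/-! Since `g` is strictly differentiable near `S ∩ dom f`, every chosen subgradient is forced: `w n`
is the gradient of `g` at `x n`, and this gradient is continuous there. The algorithm is then
analysed in two stages.

Descent. Comparing the new iterate with the old one in the subproblem, and using the gradient
inequality for `fs`, the descent lemma and the weak convexity of `g`, bounds `f (x (n+1))` by `θ_n *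
g (x (n+1))` plus a multiple of the previous squared step, plus a cross term, minus a multiple of
the new squared step (`IsEPSG.numerator_le`). Dividing by `g` makes `θ_n + a ‖x_n - x_{n-1}‖²` a
Lyapunov function; the parameter bounds say exactly that it decreases strictly enough. Hence the
steps tend to `0` and `θ_n` converges to some `t` (`IsEPSG.asymptotics`).

Limit. Optimality of the new iterate gives a quadratic minorant of `fn` on the feasible set, hence
an explicit Fréchet subgradient of `f + ι_S` taken as a whole, with no sum rule. The quotient rule
`frechetSubdiff_div` turns it into one of `f/g + ι_S`. Along a subsequence converging to the cluster
point the numerator subgradients tend to `t ∇g`, so the quotient subgradients tend to `0`.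
Convergence of the function values, also required by the limiting subdifferential, follows from
lower semicontinuity on one side and from the minorant tested at the cluster point on the other. -/

theorem FiniteAt.coe_toReal {X : Type*} {h : X → EReal} {x : X} (hx : FiniteAt h x) :
    ((h x).toReal : EReal) = h x :=
  EReal.coe_toReal hx.2 hx.1

theorem neg_lt_diffQuot_iff {y : EReal} {a r t ε : ℝ} (ht : 0 < t) :
    ((-ε : ℝ) : EReal) < (y - a - (r : EReal)) / (t : EReal) ↔
      ((a + r - ε * t : ℝ) : EReal) < y := by
  rw [EReal.lt_div_iff (by exact_mod_cast ht) (EReal.coe_ne_top _)]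
  induction y with
  | bot => simp
  | top =>
    rw [EReal.top_sub_coe, EReal.top_sub_coe, ← EReal.coe_mul]
    simp only [EReal.coe_lt_top]
  | coe y =>
    norm_cast
    constructor <;> intro h <;> linarith

/-- Fréchet subgradients in terms of local affine minorants. -/
theorem mem_frechetSubdiff_iff {h : H → EReal} {x u : H} :
    u ∈ frechetSubdiff h x ↔ FiniteAt h x ∧ ∀ ε : ℝ, 0 < ε → ∀ᶠ z in 𝓝 x,
      (((h x).toReal + inner ℝ u (z - x) - ε * ‖z - x‖ : ℝ) : EReal) ≤ h z := by
  unfold frechetSubdiff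
  refine and_congr_right fun hx => ?_
  have key : ∀ (ε : ℝ) (z : H), z ≠ x →
      (((-ε : ℝ) : EReal) < (h z - h x - ((inner ℝ u (z - x) : ℝ) : EReal)) /
          ((‖z - x‖ : ℝ) : EReal) ↔
        (((h x).toReal + inner ℝ u (z - x) - ε * ‖z - x‖ : ℝ) : EReal) < h z) := by
    intro ε z hz
    rw [← hx.coe_toReal]
    exact neg_lt_diffQuot_iff (norm_pos_iff.2 (sub_ne_zero.2 hz))
  rw [le_liminf_iff]
  constructor
  · intro hl ε hε
    have h1 := hl ((-ε : ℝ) : EReal) (by exact_mod_cast neg_lt_zero.2 hε)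
    rw [eventually_nhdsWithin_iff] at h1
    filter_upwards [h1] with z hz
    by_cases hzx : z = x
    · subst hzx
      simp [hx.coe_toReal]
    · exact ((key ε z hzx).1 (hz hzx)).le
  · intro hl b hb
    obtain ⟨c, hbc, hc⟩ := EReal.lt_iff_exists_real_btwn.1 hb
    have hc' : c < 0 := by exact_mod_cast hc
    have h1 := hl (-c / 2) (by linarith)
    rw [eventually_nhdsWithin_iff]
    filter_upwards [h1] with z hz hzx
    refine hbc.trans ?_
    have := (key (-c) z hzx).2 (lt_of_lt_of_le ?_ hz)
    · simpa using this
    · have : 0 < ‖z - x‖ := norm_pos_iff.2 (sub_ne_zero.2 hzx)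
      norm_cast
      nlinarith

variable [CompleteSpace H]

theorem eventually_abs_sub_inner_le {r : H → ℝ} {v p : H} (hr : HasGradientAt r v p)
    {ε : ℝ} (hε : 0 < ε) :
    ∀ᶠ z in 𝓝 p, |r z - r p - inner ℝ v (z - p)| ≤ ε * ‖z - p‖ :=
  (hasGradientAt_iff_isLittleO.1 hr).bound hε

/-- The quadratic term is `o(‖z - p‖)` and `r` is linear to first order, so only `v - a` survives.
This is the form in which optimality in the subproblem is used. -/
theorem sub_mem_frechetSubdiff_of_minorant {h : H → EReal} {r : H → ℝ} {v p a : H} {K : ℝ}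
    (hp : FiniteAt h p) (hr : HasGradientAt r v p)
    (hmin : ∀ z, (((h p).toReal + (r z - r p) - inner ℝ a (z - p) - K * ‖z - p‖ ^ 2 : ℝ) : EReal)
      ≤ h z) : v - a ∈ frechetSubdiff h p := by
  refine mem_frechetSubdiff_iff.2 ⟨hp, fun ε hε => ?_⟩
  have hK : ∀ᶠ z in 𝓝 p, K * ‖z - p‖ < ε / 2 := by
    have : Tendsto (fun z : H => K * ‖z - p‖) (𝓝 p) (𝓝 (K * ‖p - p‖)) := by
      apply Continuous.tendsto (by fun_prop)
    rw [sub_self, norm_zero, mul_zero] at this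
    exact this.eventually (gt_mem_nhds (by linarith))
  filter_upwards [eventually_abs_sub_inner_le hr (half_pos hε), hK] with z h1 h2
  refine le_trans ?_ (hmin z)
  norm_cast
  have h3 := (abs_le.1 h1).1
  have h4 := mul_le_mul_of_nonneg_right h2.le (norm_nonneg (z - p))
  rw [inner_sub_left]
  nlinarith

theorem eq_gradient_of_mem_frechetSubdiff {h : H → EReal} {v p u : H}
    (hfin : ∀ᶠ z in 𝓝 p, FiniteAt h z) (hr : HasGradientAt (fun z => (h z).toReal) v p)
    (hu : u ∈ frechetSubdiff h p) : u = v := by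
  obtain ⟨hp, hmem⟩ := mem_frechetSubdiff_iff.1 hu
  by_contra hne
  set d := u - v with hd
  have hd0 : 0 < ‖d‖ := norm_pos_iff.2 (sub_ne_zero.2 hne)
  have hev : ∀ᶠ z in 𝓝 p, inner ℝ d (z - p) ≤ ‖d‖ / 2 * ‖z - p‖ := by
    filter_upwards [hfin, eventually_abs_sub_inner_le hr (show 0 < ‖d‖ / 4 by linarith),
      hmem (‖d‖ / 4) (by linarith)] with z hz h1 h2
    rw [← hz.coe_toReal] at h2
    have h2' : (h p).toReal + inner ℝ u (z - p) - ‖d‖ / 4 * ‖z - p‖ ≤ (h z).toReal := by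
      exact_mod_cast h2
    have h3 := (abs_le.1 h1).2
    rw [hd, inner_sub_left]
    linarith
  have hlim : Tendsto (fun t : ℝ => p + t • d) (𝓝[>] 0) (𝓝 p) := by
    have : Tendsto (fun t : ℝ => p + t • d) (𝓝 0) (𝓝 (p + (0 : ℝ) • d)) :=
      Continuous.tendsto (by fun_prop) _
    rw [zero_smul, add_zero] at this
    exact this.mono_left nhdsWithin_le_nhds
  -- Moving from `p` in the direction `d = u - v` itself turns the bound into `t‖d‖² ≤ t‖d‖²/2`.
  obtain ⟨t, ht, ht0⟩ := ((hlim.eventually hev).and self_mem_nhdsWithin).exists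
  have ht0 : 0 < t := ht0
  rw [add_sub_cancel_left, real_inner_smul_right, norm_smul, Real.norm_of_nonneg ht0.le,
    real_inner_self_eq_norm_sq] at ht
  have : 0 < t * ‖d‖ ^ 2 := by positivity
  nlinarith

/-- Near a point of strict differentiability, gradients are close to the gradient there. -/
theorem tendsto_gradient_of_hasStrictFDerivAt {ι : Type*} {l : Filter ι} {r : H → ℝ}
    {L : H →L[ℝ] ℝ} {p : H} (hr : HasStrictFDerivAt r L p) {y v : ι → H}
    (hy : Tendsto y l (𝓝 p)) (hv : ∀ᶠ i in l, HasGradientAt r (v i) (y i)) :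
    Tendsto v l (𝓝 (gradient r p)) := by
  have hLg : (InnerProductSpace.toDual ℝ H) (gradient r p) = L := by
    rw [toDual_gradient, hr.hasFDerivAt.fderiv]
  rw [Metric.tendsto_nhds]
  intro ε hε
  obtain ⟨c, hc⟩ : ∃ c : ℝ≥0, (c : ℝ) = ε / 2 :=
    ⟨(ε / 2).toNNReal, Real.coe_toNNReal _ (half_pos hε).le⟩
  -- Strict differentiability makes `r - L` Lipschitz with constant `ε/2` on a neighbourhood of `p`,
  -- which bounds its derivative `v i - L` at every nearby `y i`.
  obtain ⟨s, hs, hlip⟩ := hr.approximates_deriv_on_nhds (c := c)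
    (Or.inr (by rw [← NNReal.coe_pos, hc]; exact half_pos hε))
  have hs' : ∀ᶠ z in 𝓝 p, s ∈ 𝓝 z := eventually_mem_nhds_iff.2 hs
  filter_upwards [hy.eventually hs', hv] with i hi hvi
  have h1 : HasFDerivAt (fun z => r z - L z)
      ((InnerProductSpace.toDual ℝ H) (v i) - L) (y i) := hvi.hasFDerivAt.sub L.hasFDerivAt
  have h2 := h1.le_of_lipschitzOn hi hlip.lipschitzOnWith
  rw [← hLg, ← map_sub, LinearIsometryEquiv.norm_map, hc] at h2
  rw [dist_eq_norm]
  linarith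

theorem StrictDiffAt.hasGradientAt {h : H → EReal} {p : H} (hs : StrictDiffAt h p) :
    HasGradientAt (fun z => (h z).toReal) (gradient (fun z => (h z).toReal) p) p := by
  obtain ⟨L, hL⟩ := hs.2
  exact hL.hasFDerivAt.differentiableAt.hasGradientAt

theorem tendsto_gradient_of_strictDiffAt {ι : Type*} {l : Filter ι} {h : H → EReal} {U : Set H}
    (hU : IsOpen U) (hs : ∀ y ∈ U, StrictDiffAt h y) {p : H} (hp : p ∈ U) {y : ι → H}
    (hy : Tendsto y l (𝓝 p)) :
    Tendsto (fun i => gradient (fun z => (h z).toReal) (y i)) l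
      (𝓝 (gradient (fun z => (h z).toReal) p)) := by
  obtain ⟨L, hL⟩ := (hs p hp).2
  refine tendsto_gradient_of_hasStrictFDerivAt hL hy ?_
  filter_upwards [hy.eventually (hU.mem_nhds hp)] with i hi
  exact (hs _ hi).hasGradientAt

theorem eq_gradient_of_mem_limitingSubdiff {h : H → EReal} {U : Set H}
    (hU : IsOpen U) (hs : ∀ y ∈ U, StrictDiffAt h y) {p u : H} (hp : p ∈ U)
    (hu : u ∈ limitingSubdiff h p) : u = gradient (fun z => (h z).toReal) p := by
  obtain ⟨-, xs, us, hxs, -, hus, hmem⟩ := hu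
  refine tendsto_nhds_unique hus ((tendsto_gradient_of_strictDiffAt hU hs hp hxs).congr' ?_)
  filter_upwards [hxs.eventually (hU.mem_nhds hp)] with n hn
  exact (eq_gradient_of_mem_frechetSubdiff (hs _ hn).1 (hs _ hn).hasGradientAt (hmem n)).symm

/-! ### The quotient rule. -/

/-- Primes denote values at the nearby point, `a` and `b` the linear increments and `t` the
distance. The numerator is only bounded below, so the signs of `F` and `G` matter; `c` absorbs the
error of replacing `1 / (G' * G)` by `1 / G ^ 2`. -/
theorem lower_bound_div {F G F' G' a b ε c t : ℝ} (hG' : 0 < G') (hG : 0 < G)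
    (hF : F + a - ε * t ≤ F') (hGb : |G' - G - b| ≤ ε * t) (hF0 : 0 ≤ F)
    (hc : |(G * a - F * b) * (1 / (G' * G) - 1 / G ^ 2)| ≤ c * t) :
    F / G + (G * a - F * b) / G ^ 2 - (c + ε * (G + F) / (G' * G)) * t ≤ F' / G' := by
  have e1 : F' / G' - F / G = (G * (F' - F) - F * (G' - G)) * (1 / (G' * G)) := by
    field_simp; ring
  have h1 : G * a - F * b - ε * (G + F) * t ≤ G * (F' - F) - F * (G' - G) := by
    have := mul_le_mul_of_nonneg_left (abs_le.1 hGb).2 hF0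
    nlinarith
  have h2 := mul_le_mul_of_nonneg_right h1 (show 0 ≤ 1 / (G' * G) by positivity)
  have h3 := (abs_le.1 hc).1
  have e2 : (c + ε * (G + F) / (G' * G)) * t = c * t + ε * (G + F) * t * (1 / (G' * G)) := by ring
  have e3 : (G * a - F * b) / G ^ 2 = (G * a - F * b) * (1 / G ^ 2) := by ring
  rw [e2, e3]
  linarith

/-- Quotient rule for Fréchet subgradients with a differentiable positive denominator. -/
theorem frechetSubdiff_div {f g : H → EReal} {S : Set H} {p u v : H}
    (hgpos : ∀ z ∈ S, 0 < g z ∧ g z < ⊤) (hfbot : ∀ z, f z ≠ ⊥) (hpS : p ∈ S)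
    (hf0 : 0 ≤ (f p).toReal)
    (hg : HasGradientAt (fun z => (g z).toReal) v p)
    (hu : u ∈ frechetSubdiff (addIndicator f S) p) :
    ((g p).toReal ^ 2)⁻¹ • ((g p).toReal • u - (f p).toReal • v) ∈
      frechetSubdiff (addIndicator (fun z => f z / g z) S) p := by
  obtain ⟨hfin, hmem⟩ := mem_frechetSubdiff_iff.1 hu
  have hfp : FiniteAt f p := by simpa [FiniteAt, addIndicator, hpS] using hfin
  have hgfin : ∀ z ∈ S, FiniteAt g z := fun z hz =>
    ⟨((EReal.bot_lt_zero).trans (hgpos z hz).1).ne', (hgpos z hz).2.ne⟩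
  have hgreal : ∀ z ∈ S, 0 < (g z).toReal := fun z hz =>
    EReal.toReal_pos (hgpos z hz).1 (hgpos z hz).2.ne
  have hdiv : ∀ z ∈ S, FiniteAt f z →
      f z / g z = (((f z).toReal / (g z).toReal : ℝ) : EReal) := by
    intro z hz hfz
    rw [EReal.coe_div, hfz.coe_toReal, (hgfin z hz).coe_toReal]
  set F := (f p).toReal with hF
  set G := (g p).toReal with hG
  have hGpos : 0 < G := hgreal p hpS
  have hval : addIndicator (fun z => f z / g z) S p = ((F / G : ℝ) : EReal) := by
    simp only [addIndicator, hpS, if_true]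
    exact hdiv p hpS hfp
  have hvalf : addIndicator f S p = f p := by simp only [addIndicator, hpS, if_true]
  refine mem_frechetSubdiff_iff.2 ⟨?_, fun ε hε => ?_⟩
  · unfold FiniteAt
    rw [hval]
    exact ⟨EReal.coe_ne_bot _, EReal.coe_ne_top _⟩
  rw [hval, EReal.toReal_coe]
  rw [hvalf] at hmem
  set q := G • u - F • v with hq
  have hgc : Tendsto (fun z => (g z).toReal) (𝓝 p) (𝓝 G) := hg.continuousAt
  have hlim1 : Tendsto (fun z => ‖q‖ * |1 / ((g z).toReal * G) - 1 / G ^ 2|) (𝓝 p) (𝓝 0) := by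
    have : Tendsto (fun z => ‖q‖ * |1 / ((g z).toReal * G) - 1 / G ^ 2|) (𝓝 p)
        (𝓝 (‖q‖ * |1 / (G * G) - 1 / G ^ 2|)) :=
      (((tendsto_const_nhds.div (hgc.mul_const G) (by positivity)).sub_const _).abs).const_mul _
    simpa [sq] using this
  -- Chosen so that `η (G + F) / G²` is `ε/4`: near `p` this error stays below `ε/2`, leaving `ε/2`
  -- for the change of denominator.
  set η := ε * G ^ 2 / (4 * (G + F)) with hη
  have hηpos : 0 < η := by positivity
  have hlim2 : Tendsto (fun z => η * (G + F) / ((g z).toReal * G)) (𝓝 p)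
      (𝓝 (η * (G + F) / (G * G))) :=
    tendsto_const_nhds.div (hgc.mul_const G) (by positivity)
  have hval2 : η * (G + F) / (G * G) < ε / 2 := by
    have : η * (G + F) / (G * G) = ε / 4 := by
      have : G + F ≠ 0 := by positivity
      rw [hη]; field_simp
    linarith
  filter_upwards [hmem η hηpos, eventually_abs_sub_inner_le hg hηpos,
    hlim1.eventually (gt_mem_nhds (half_pos hε)),
    hlim2.eventually (gt_mem_nhds hval2)] with z h1 h2 h3 h4
  by_cases hzS : z ∈ S
  swap
  · simp [addIndicator, hzS]
  simp only [addIndicator, hzS, if_true] at h1 ⊢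
  by_cases hfz : f z = ⊤
  · rw [hfz, EReal.top_div_of_pos_ne_top (hgpos z hzS).1 (hgpos z hzS).2.ne]
    exact le_top
  have hfzf : FiniteAt f z := ⟨hfbot z, hfz⟩
  rw [hdiv z hzS hfzf]
  rw [← hfzf.coe_toReal] at h1
  have h1' : F + inner ℝ u (z - p) - η * ‖z - p‖ ≤ (f z).toReal := by exact_mod_cast h1
  have hqi : inner ℝ q (z - p) = G * inner ℝ u (z - p) - F * inner ℝ v (z - p) := by
    rw [hq, inner_sub_left, real_inner_smul_left, real_inner_smul_left]
  have h5 := lower_bound_div (hgreal z hzS) hGpos h1' h2 hf0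
    (c := ‖q‖ * |1 / ((g z).toReal * G) - 1 / G ^ 2|) (by
      rw [← hqi, abs_mul]
      have := mul_le_mul_of_nonneg_right (abs_real_inner_le_norm q (z - p))
        (abs_nonneg (1 / ((g z).toReal * G) - 1 / G ^ 2))
      linarith)
  norm_cast
  rw [← hqi] at h5
  rw [real_inner_smul_left, inv_mul_eq_div]
  have h6 := mul_le_mul_of_nonneg_right (add_lt_add h3 h4).le (norm_nonneg (z - p))
  rw [add_halves] at h6
  linarith

/-! ### Descent lemma and gradient inequality. -/

theorem monotone_comparison {ψ ψ' : ℝ → ℝ} (hψ : ∀ t, HasDerivAt ψ (ψ' t) t)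
    (hle : ∀ t ∈ Icc (0 : ℝ) 1, ψ' t ≤ 0) : ψ 1 ≤ ψ 0 := by
  have : AntitoneOn ψ (Icc 0 1) := by
    refine antitoneOn_of_deriv_nonpos (convex_Icc 0 1)
      (fun t _ => (hψ t).continuousAt.continuousWithinAt)
      (fun t _ => (hψ t).differentiableAt.differentiableWithinAt) fun t ht => ?_
    rw [(hψ t).deriv]
    exact hle t (interior_subset ht)
  exact this (by simp) (by simp) zero_le_one

/-- The descent lemma. -/
theorem le_quadratic_of_lipschitz_gradient {r : H → ℝ} {ℓ : ℝ≥0} (hd : Differentiable ℝ r)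
    (hl : LipschitzWith ℓ (gradient r)) (u y : H) :
    r y ≤ r u + inner ℝ (gradient r u) (y - u) + ℓ / 2 * ‖y - u‖ ^ 2 := by
  set e := y - u with he
  have hline : ∀ t : ℝ, HasDerivAt (fun t : ℝ => u + t • e) e t := fun t => by
    simpa using ((hasDerivAt_id t).smul_const e).const_add u
  have hcomp : ∀ t : ℝ, HasDerivAt (fun t : ℝ => r (u + t • e))
      (inner ℝ (gradient r (u + t • e)) e) t := fun t => by
    have := (hd (u + t • e)).hasGradientAt.hasFDerivAt.comp_hasDerivAt t (hline t)
    simpa [Function.comp_def] using this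
  -- Along the segment, the function minus its claimed quadratic bound has nonpositive derivative,
  -- by Cauchy–Schwarz and the Lipschitz gradient.
  have hψ : ∀ t : ℝ, HasDerivAt
      (fun t : ℝ => r (u + t • e) - t * inner ℝ (gradient r u) e - ℓ / 2 * ‖e‖ ^ 2 * t ^ 2)
      (inner ℝ (gradient r (u + t • e)) e - 1 * inner ℝ (gradient r u) e
        - ℓ / 2 * ‖e‖ ^ 2 * (2 * t)) t := fun t => by
    refine ((hcomp t).sub ((hasDerivAt_id t).mul_const _)).sub ?_
    simpa using (hasDerivAt_pow 2 t).const_mul ((ℓ : ℝ) / 2 * ‖e‖ ^ 2)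
  have := monotone_comparison hψ fun t ht => by
    have h1 : inner ℝ (gradient r (u + t • e) - gradient r u) e ≤ ℓ * t * ‖e‖ ^ 2 := by
      refine (real_inner_le_norm _ _).trans ?_
      have h2 := hl.dist_le_mul (u + t • e) u
      rw [dist_eq_norm, dist_eq_norm, add_sub_cancel_left, norm_smul,
        Real.norm_of_nonneg ht.1] at h2
      calc _ ≤ (ℓ * (t * ‖e‖)) * ‖e‖ := mul_le_mul_of_nonneg_right h2 (norm_nonneg _)
        _ = _ := by ring
    rw [inner_sub_left] at h1
    linarith
  simp only [one_smul, zero_smul, add_zero, one_pow, mul_one, one_mul, zero_mul, ne_eq,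
    OfNat.ofNat_ne_zero, not_false_eq_true, zero_pow, mul_zero, sub_zero] at this
  rw [he, add_sub_cancel, ← he] at this
  linarith

/-- Gradient inequality for a function which becomes convex on the convex set `S` after adding
`β/2 ‖·‖²`. -/
theorem gradient_inequality {r : H → ℝ} {S : Set H} {β : ℝ}
    (hc : ConvexOn ℝ S fun z => r z + β / 2 * ‖z‖ ^ 2) {p y v : H} (hp : p ∈ S) (hy : y ∈ S)
    (hr : HasGradientAt r v p) :
    r p + inner ℝ v (y - p) - β / 2 * ‖y - p‖ ^ 2 ≤ r y := by
  set e := y - p with he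
  refine le_of_forall_pos_le_add fun ε hε => ?_
  have hlim : Tendsto (fun t : ℝ => p + t • e) (𝓝[>] 0) (𝓝 p) := by
    have : Tendsto (fun t : ℝ => p + t • e) (𝓝 0) (𝓝 (p + (0 : ℝ) • e)) :=
      Continuous.tendsto (by fun_prop) _
    rw [zero_smul, add_zero] at this
    exact this.mono_left nhdsWithin_le_nhds
  -- Expanding the squares in the convexity inequality and dividing by `t` leaves the remainder `t
  -- (β/2) ‖e‖²`. As `β` has no sign here, it is only made larger than `-ε/2`.
  have hsmall : ∀ᶠ t : ℝ in 𝓝[>] 0, t < 1 ∧ t * (β / 2 * ‖e‖ ^ 2) > - (ε / 2) := by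
    refine nhdsWithin_le_nhds ((gt_mem_nhds one_pos).and ?_)
    have : Tendsto (fun t : ℝ => t * (β / 2 * ‖e‖ ^ 2)) (𝓝 0) (𝓝 (0 * (β / 2 * ‖e‖ ^ 2))) :=
      Continuous.tendsto (by fun_prop) _
    rw [zero_mul] at this
    exact this.eventually (lt_mem_nhds (by linarith))
  have hε' : 0 < ε / (2 * (‖e‖ + 1)) := by positivity
  obtain ⟨t, ⟨h1, ht1, ht2⟩, ht0⟩ := ((hlim.eventually
    (eventually_abs_sub_inner_le hr hε')).and hsmall |>.and self_mem_nhdsWithin).exists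
  have ht0 : 0 < t := ht0
  have h2 := hc.2 hp hy (sub_nonneg.2 ht1.le) ht0.le (sub_add_cancel 1 t)
  have e1 : (1 - t) • p + t • y = p + t • e := by rw [he]; module
  rw [e1] at h2
  simp only [smul_eq_mul] at h2
  rw [add_sub_cancel_left, real_inner_smul_right, norm_smul, Real.norm_of_nonneg ht0.le] at h1
  have h3 := (abs_le.1 h1).1
  have e2 : ‖p + t • e‖ ^ 2 = ‖p‖ ^ 2 + 2 * t * inner ℝ p e + t ^ 2 * ‖e‖ ^ 2 := by
    rw [norm_add_sq_real, real_inner_smul_right, norm_smul, Real.norm_of_nonneg ht0.le]; ring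
  have e3 : ‖y‖ ^ 2 = ‖p‖ ^ 2 + 2 * inner ℝ p e + ‖e‖ ^ 2 := by
    have : y = p + e := by rw [he]; abel
    rw [this, norm_add_sq_real]
  have h4 : ε / (2 * (‖e‖ + 1)) * (t * ‖e‖) ≤ t * (ε / 2) := by
    have : ε / (2 * (‖e‖ + 1)) * ‖e‖ ≤ ε / 2 := by
      rw [div_mul_eq_mul_div, div_le_div_iff₀ (by positivity) two_pos]
      nlinarith [norm_nonneg e]
    nlinarith
  rw [e2, e3] at h2
  have h5 : t * (r p + inner ℝ v e - β / 2 * ‖e‖ ^ 2) ≤ t * (r y + ε) := by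
    nlinarith
  exact le_of_mul_le_mul_left h5 ht0

end

/-! ### Real inequalities behind the Lyapunov argument. -/

section

variable {H : Type*} [NormedAddCommGroup H] [InnerProductSpace ℝ H]

/-- The energy `θ n + a * d n ^ 2` drops by at least `(a - b) * d n ^ 2` at each step and is bounded
below, so it converges and the drops vanish. -/
theorem convergence_of_lyapunov {θ d : ℕ → ℝ} {a b : ℝ} (hb : 0 ≤ b) (hba : b < a)
    (hθ : ∀ n, 0 ≤ θ n) (hd : d 0 = 0)
    (hstep : ∀ n, θ (n + 1) + a * d (n + 1) ^ 2 ≤ θ n + b * d n ^ 2) :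
    (∀ n, θ n ≤ θ 0) ∧ Tendsto d atTop (𝓝 0) ∧ ∃ t, Tendsto θ atTop (𝓝 t) := by
  set E : ℕ → ℝ := fun n => θ n + a * d n ^ 2 with hE
  have hdec : ∀ n, (a - b) * d n ^ 2 ≤ E n - E (n + 1) := fun n => by
    have := hstep n
    simp only [hE]
    linarith
  have hanti : Antitone E := antitone_nat_of_succ_le fun n => by
    have := hdec n
    have : 0 ≤ (a - b) * d n ^ 2 := mul_nonneg (by linarith) (sq_nonneg _)
    linarith
  have hθE : ∀ n, θ n ≤ E n := fun n => by
    have : 0 ≤ a * d n ^ 2 := mul_nonneg (by linarith) (sq_nonneg _)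
    simp only [hE]
    linarith
  have hE0 : E 0 = θ 0 := by simp [hE, hd]
  have hlim : ∃ t, Tendsto E atTop (𝓝 t) :=
    ⟨_, tendsto_atTop_ciInf hanti ⟨0, by rintro _ ⟨n, rfl⟩; exact (hθ n).trans (hθE n)⟩⟩
  obtain ⟨t, ht⟩ := hlim
  have hdiff : Tendsto (fun n => (E n - E (n + 1)) / (a - b)) atTop (𝓝 0) := by
    have := (ht.sub (ht.comp (tendsto_add_atTop_nat 1))).div_const (a - b)
    simpa using this
  have hsq : Tendsto (fun n => d n ^ 2) atTop (𝓝 0) :=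
    squeeze_zero (fun n => sq_nonneg _) (fun n => by
      rw [le_div_iff₀ (by linarith), mul_comm]
      exact hdec n) hdiff
  refine ⟨fun n => ((hθE n).trans (hanti (Nat.zero_le n))).trans hE0.le, ?_, t, ?_⟩
  · have h1 := hsq.sqrt
    simp only [Real.sqrt_sq_eq_abs, Real.sqrt_zero] at h1
    exact (tendsto_zero_iff_abs_tendsto_zero d).2 h1
  · have h1 := ht.sub (hsq.const_mul a)
    simpa [hE] using h1

/-- The decrease estimate for one iteration. -/
theorem numerator_step {p d w v₀ : H} {ℓ κ κbar μ μbar τ θ β c s0 s1 su n0 n1 g0 g1 : ℝ}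
    (hℓ : 0 ≤ ℓ) (hτ : 0 < τ) (hκ : κ ∈ Icc 0 κbar) (hμ : μ ∈ Icc 0 (μbar * τ)) (hθ : 0 ≤ θ)
    (hc : c ≤ 1 / τ - β * θ)
    (hmin : n1 + inner ℝ v₀ (p - κ • d) + 1 / (2 * τ) * ‖p - μ • d - (τ * θ) • w‖ ^ 2
        + ℓ / 2 * ‖p - κ • d‖ ^ 2 ≤
      n0 + inner ℝ v₀ (-(κ • d)) + 1 / (2 * τ) * ‖-(μ • d) - (τ * θ) • w‖ ^ 2
        + ℓ / 2 * ‖-(κ • d)‖ ^ 2)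
    (hconv : su + inner ℝ v₀ (-(κ • d)) ≤ s0)
    (hdesc : s1 ≤ su + inner ℝ v₀ (p - κ • d) + ℓ / 2 * ‖p - κ • d‖ ^ 2)
    (hg : g0 + inner ℝ w p - β / 2 * ‖p‖ ^ 2 ≤ g1) (hfg : s0 + n0 = θ * g0) :
    s1 + n1 ≤ θ * g1 + ℓ * κbar ^ 2 / 2 * ‖d‖ ^ 2 + μbar * (‖p‖ * ‖d‖) - c / 2 * ‖p‖ ^ 2 := by
  -- Here `p` is the new step, `d` the previous one and `v₀` the gradient of `fs` at the
  -- extrapolated point. The common square cancels; the term `ℓ/2 ‖p - κ • d‖²` will cancel between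
  -- `hmin` and `hdesc`.
  have e1 : 1 / (2 * τ) * ‖-(μ • d) - (τ * θ) • w‖ ^ 2
      - 1 / (2 * τ) * ‖p - μ • d - (τ * θ) • w‖ ^ 2
      = -(1 / τ / 2) * ‖p‖ ^ 2 + μ / τ * inner ℝ p d + θ * inner ℝ w p := by
    have h1 : ‖p - μ • d - (τ * θ) • w‖ ^ 2 = ‖p‖ ^ 2
        + 2 * inner ℝ p (-(μ • d) - (τ * θ) • w) + ‖-(μ • d) - (τ * θ) • w‖ ^ 2 := by
      rw [← norm_add_sq_real]
      congr 2
      abel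
    rw [h1, inner_sub_right, inner_neg_right, real_inner_smul_right, real_inner_smul_right,
      real_inner_comm p w]
    field_simp
    ring
  have h2 : ‖-(κ • d)‖ ^ 2 ≤ κbar ^ 2 * ‖d‖ ^ 2 := by
    rw [norm_neg, norm_smul, Real.norm_of_nonneg hκ.1, mul_pow]
    have := pow_le_pow_left₀ hκ.1 hκ.2 2
    gcongr
  have h3 : ℓ / 2 * ‖-(κ • d)‖ ^ 2 ≤ ℓ * κbar ^ 2 / 2 * ‖d‖ ^ 2 := by
    have := mul_le_mul_of_nonneg_left h2 (show 0 ≤ ℓ / 2 by positivity)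
    linarith
  have h4 : μ / τ * inner ℝ p d ≤ μbar * (‖p‖ * ‖d‖) := by
    have h5 : μ / τ ≤ μbar := (div_le_iff₀ hτ).2 hμ.2
    have h6 : 0 ≤ μ / τ := div_nonneg hμ.1 hτ.le
    calc _ ≤ μ / τ * (‖p‖ * ‖d‖) := mul_le_mul_of_nonneg_left (real_inner_le_norm p d) h6
      _ ≤ _ := mul_le_mul_of_nonneg_right h5 (by positivity)
  have h7 := mul_le_mul_of_nonneg_left hg hθ
  have h8 := mul_le_mul_of_nonneg_right hc (sq_nonneg ‖p‖)
  nlinarith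

/-- The cross term is split by a weighted Young inequality. The weight `√(m * M)` is the one for
which, after division by `M` on the new step and by `m` on the old, both sides receive the same
coefficient `μ / √(m * M)`. -/
theorem ratio_step {θ f1 g1 A μ c m M P D : ℝ} (hm : 0 < m) (hM : 0 < M) (hmg : m ≤ g1)
    (hgM : g1 ≤ M) (hA : 0 ≤ A) (hμ : 0 ≤ μ) (hc : μ / √(m * M) ≤ c / M)
    (h : f1 ≤ θ * g1 + A / 2 * D ^ 2 + μ * (P * D) - c / 2 * P ^ 2) :
    f1 / g1 + (c / M - μ / √(m * M)) / 2 * P ^ 2 ≤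
      θ + (A / m + μ / √(m * M)) / 2 * D ^ 2 := by
  have hg : 0 < g1 := hm.trans_le hmg
  have hs : 0 < √(m * M) := Real.sqrt_pos.2 (mul_pos hm hM)
  have hs2 : √(m * M) ^ 2 = m * M := Real.sq_sqrt (mul_pos hm hM).le
  set s := √(m * M)
  have young : P * D ≤ M / s / 2 * P ^ 2 + s / M / 2 * D ^ 2 := by
    have e : M / s / 2 * P ^ 2 + s / M / 2 * D ^ 2 - P * D = (M * P - s * D) ^ 2 / (2 * s * M) := by
      field_simp
      ring
    have : 0 ≤ (M * P - s * D) ^ 2 / (2 * s * M) := by positivity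
    linarith
  have hX : 0 ≤ (c / M - μ / s) / 2 * P ^ 2 :=
    mul_nonneg (by linarith) (sq_nonneg _)
  have hY : 0 ≤ (A / m + μ / s) / 2 * D ^ 2 := by positivity
  have e1 : μ * (M / s / 2 * P ^ 2) - c / 2 * P ^ 2 = - (M * ((c / M - μ / s) / 2 * P ^ 2)) := by
    field_simp
    ring
  have e2 : A / 2 * D ^ 2 + μ * (s / M / 2 * D ^ 2) = m * ((A / m + μ / s) / 2 * D ^ 2) := by
    have : s / M = m / s := by
      rw [div_eq_div_iff hM.ne' hs.ne', ← hs2]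
      ring
    rw [this]
    field_simp
  have h1 := mul_le_mul_of_nonneg_left young hμ
  have h2 := mul_le_mul_of_nonneg_right hmg hY
  have h3 := mul_le_mul_of_nonneg_right hgM hX
  have h4 : f1 ≤ (θ + (A / m + μ / s) / 2 * D ^ 2 - (c / M - μ / s) / 2 * P ^ 2) * g1 := by
    nlinarith
  have h5 := (div_le_iff₀ hg).2 h4
  linarith

/-- The bound on `κ`, squared and multiplied by `ℓ / m`, is precisely the condition `b < a` of
`convergence_of_lyapunov`. For `ℓ = 0` the bound on `μ` alone gives it. -/
theorem parameters_gap {ℓ : ℝ≥0} {c m M μ κ : ℝ} (hm : 0 < m) (hM : 0 < M)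
    (hμ : μ < c * √(m * M) / (2 * M)) (hκ0 : 0 ≤ κ)
    (hκ : 0 < ℓ → κ < √(m * c / (ℓ * M) - 2 * m * μ / (ℓ * √(m * M)))) :
    (ℓ * κ ^ 2 / m + μ / √(m * M)) / 2 < (c / M - μ / √(m * M)) / 2 := by
  have hs : 0 < √(m * M) := Real.sqrt_pos.2 (mul_pos hm hM)
  set s := √(m * M)
  suffices h : ℓ * κ ^ 2 / m + 2 * (μ / s) < c / M by linarith
  rcases (zero_le : 0 ≤ ℓ).eq_or_lt with h0 | h0
  · rw [← h0, NNReal.coe_zero, zero_mul, zero_div, zero_add]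
    rw [lt_div_iff₀ (by positivity)] at hμ
    rw [← mul_div_assoc, div_lt_div_iff₀ hs hM]
    linarith
  · have hℓ : (0 : ℝ) < ℓ := NNReal.coe_pos.2 h0
    have h1 := (Real.lt_sqrt hκ0).1 (hκ h0)
    have h2 := mul_lt_mul_of_pos_left h1 (div_pos hℓ hm)
    have e1 : (ℓ : ℝ) / m * (m * c / (ℓ * M) - 2 * m * μ / (ℓ * s)) = c / M - 2 * (μ / s) := by
      field_simp
    have e2 : (ℓ : ℝ) / m * κ ^ 2 = ℓ * κ ^ 2 / m := by ring
    rw [e1, e2] at h2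
    linarith

/-! ### Reduction of the assumptions to real-valued functions. -/

theorem DenominatorAssumption.toReal_pos {g : H → EReal} {S : Set H} {β : ℝ}
    (hg : DenominatorAssumption g S β) {z : H} (hz : z ∈ S) : 0 < (g z).toReal :=
  EReal.toReal_pos (hg.finite_pos z hz).1 (hg.finite_pos z hz).2.ne

theorem DenominatorAssumption.finiteAt {g : H → EReal} {S : Set H} {β : ℝ}
    (hg : DenominatorAssumption g S β) {z : H} (hz : z ∈ S) : FiniteAt g z :=
  ⟨hg.proper.2 z, (hg.finite_pos z hz).2.ne⟩

/-- If one endpoint lies outside `S` the right side should be `⊤`; as `⊤ + ⊥ = ⊥` in `EReal`, this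
needs `h` never to be `⊥`. -/
theorem WeaklyConvexOn.mono {h : H → EReal} {S O : Set H} {β : ℝ} (hw : WeaklyConvexOn h O β)
    (hSO : S ⊆ O) (hS : Convex ℝ S) (hbot : ∀ z, h z ≠ ⊥) : WeaklyConvexOn h S β := by
  have hne : ∀ z, addIndicator (fun x => h x + ((β / 2 * ‖x‖ ^ 2 : ℝ) : EReal)) S z ≠ ⊥ := by
    intro z
    unfold addIndicator
    split_ifs
    · exact EReal.add_ne_bot_iff.2 ⟨hbot z, EReal.coe_ne_bot _⟩
    · exact top_ne_bot
  have hmul : ∀ (t : ℝ) (e : EReal), 0 < t → e ≠ ⊥ → (t : EReal) * e ≠ ⊥ := by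
    intro t e ht he
    induction e with
    | bot => exact absurd rfl he
    | top => rw [EReal.coe_mul_top_of_pos ht]; exact top_ne_bot
    | coe e => rw [← EReal.coe_mul]; exact EReal.coe_ne_bot _
  intro x y a b ha hb hab
  by_cases hx : x ∈ S
  swap
  · have : addIndicator (fun x => h x + ((β / 2 * ‖x‖ ^ 2 : ℝ) : EReal)) S x = ⊤ := by
      simp [addIndicator, hx]
    rw [this, EReal.coe_mul_top_of_pos ha, EReal.top_add_of_ne_bot (hmul b _ hb (hne y))]
    exact le_top
  by_cases hy : y ∈ S
  swap
  · have : addIndicator (fun x => h x + ((β / 2 * ‖x‖ ^ 2 : ℝ) : EReal)) S y = ⊤ := by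
      simp [addIndicator, hy]
    rw [this, EReal.coe_mul_top_of_pos hb, EReal.add_top_of_ne_bot (hmul a _ ha (hne x))]
    exact le_top
  have hz := hS hx hy ha.le hb.le hab
  simpa [addIndicator, hx, hy, hz, hSO hx, hSO hy, hSO hz] using hw x y a b ha hb hab

theorem DenominatorAssumption.convexOn {g : H → EReal} {S : Set H} {β : ℝ}
    (hg : DenominatorAssumption g S β) (hS : Convex ℝ S) :
    ConvexOn ℝ S fun z => (g z).toReal + β / 2 * ‖z‖ ^ 2 := by
  have hw : WeaklyConvexOn g S β := by
    rcases hg.weaklyConvex with ⟨O, -, -, hSO, hO⟩ | ⟨-, h⟩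
    · exact hO.mono hSO hS hg.proper.2
    · exact h
  refine convexOn_iff_forall_pos.2 ⟨hS, fun x hx y hy a b ha hb hab => ?_⟩
  have hz := hS hx hy ha.le hb.le hab
  have h := hw x y a b ha hb hab
  simp only [addIndicator, hx, hy, hz, if_true] at h
  rw [← (hg.finiteAt hx).coe_toReal, ← (hg.finiteAt hy).coe_toReal,
    ← (hg.finiteAt hz).coe_toReal] at h
  simp only [smul_eq_mul]
  exact_mod_cast h

variable [CompleteSpace H] {f fn g : H → EReal} {fs : H → ℝ} {S : Set H} {ℓ : ℝ≥0}
  {β δ ζ μbar κbar : ℝ} {x w : ℕ → H} {τ κ μ : ℕ → ℝ}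

theorem NumeratorAssumption.ne_bot (hf : NumeratorAssumption f fs fn S ℓ) (z : H) : f z ≠ ⊥ := by
  rw [hf.decomp]
  exact EReal.add_ne_bot_iff.2 ⟨EReal.coe_ne_bot _, hf.fn_proper.2 z⟩

theorem NumeratorAssumption.lt_top_iff (hf : NumeratorAssumption f fs fn S ℓ) (z : H) :
    f z < ⊤ ↔ fn z < ⊤ := by
  rw [hf.decomp]
  have := hf.fn_proper.2 z
  induction h : fn z with
  | bot => exact absurd h this
  | top => simp
  | coe e =>
    rw [← EReal.coe_add]
    simp only [EReal.coe_lt_top]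

theorem NumeratorAssumption.toReal_eq (hf : NumeratorAssumption f fs fn S ℓ) {z : H}
    (hz : f z < ⊤) : (f z).toReal = fs z + (fn z).toReal := by
  rw [hf.decomp, EReal.toReal_add (EReal.coe_ne_top _) (EReal.coe_ne_bot _)
    ((hf.lt_top_iff z).1 hz).ne (hf.fn_proper.2 z), EReal.toReal_coe]

theorem NumeratorAssumption.finiteAt_fn (hf : NumeratorAssumption f fs fn S ℓ) {z : H}
    (hz : f z < ⊤) : FiniteAt fn z :=
  ⟨hf.fn_proper.2 z, ((hf.lt_top_iff z).1 hz).ne⟩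

theorem NumeratorAssumption.finiteAt (hf : NumeratorAssumption f fs fn S ℓ) {z : H}
    (hz : f z < ⊤) : FiniteAt f z :=
  ⟨hf.ne_bot z, hz.ne⟩

theorem NumeratorAssumption.toReal_nonneg (hf : NumeratorAssumption f fs fn S ℓ) {z : H}
    (hz : z ∈ S ∩ edom f) : 0 ≤ (f z).toReal :=
  EReal.toReal_nonneg (hf.nonneg z hz)

theorem NumeratorAssumption.differentiable (hf : NumeratorAssumption f fs fn S ℓ) :
    Differentiable ℝ fs :=
  hf.smooth_contDiff.differentiable one_ne_zero

theorem NumeratorAssumption.gradient_le (hf : NumeratorAssumption f fs fn S ℓ) (u y : H) :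
    fs u + inner ℝ (gradient fs u) (y - u) ≤ fs y := by
  have h := gradient_inequality (r := fs) (β := 0) (by simpa using hf.smooth_convex)
    (mem_univ u) (mem_univ y) (hf.differentiable u).hasGradientAt
  simpa using h

theorem ratio_eq_toReal_div (hf : NumeratorAssumption f fs fn S ℓ)
    (hg : DenominatorAssumption g S β) {z : H} (hz : z ∈ S ∩ edom f) :
    f z / g z = (((f z).toReal / (g z).toReal : ℝ) : EReal) := by
  rw [EReal.coe_div, (hf.finiteAt hz.2).coe_toReal, (hg.finiteAt hz.1).coe_toReal]

theorem ratio_eq (hf : NumeratorAssumption f fs fn S ℓ)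
    (hg : DenominatorAssumption g S β) {z : H} (hz : z ∈ S ∩ edom f) :
    ratio f g z = (f z).toReal / (g z).toReal := by
  rw [ratio, ratio_eq_toReal_div hf hg hz, EReal.toReal_coe]

theorem ratio_nonneg (hf : NumeratorAssumption f fs fn S ℓ)
    (hg : DenominatorAssumption g S β) {z : H} (hz : z ∈ S ∩ edom f) : 0 ≤ ratio f g z := by
  rw [ratio_eq hf hg hz]
  exact div_nonneg (hf.toReal_nonneg hz) (hg.toReal_pos hz.1).le

theorem ratio_mul (hf : NumeratorAssumption f fs fn S ℓ)
    (hg : DenominatorAssumption g S β) {z : H} (hz : z ∈ S ∩ edom f) :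
    ratio f g z * (g z).toReal = (f z).toReal := by
  rw [ratio_eq hf hg hz, div_mul_cancel₀ _ (hg.toReal_pos hz.1).ne']

/-! ### Descent along the iterates. -/

theorem IsEPSG.mem (h : IsEPSG f fs fn g S ℓ β δ ζ μbar κbar x w τ κ μ)
    (hf : NumeratorAssumption f fs fn S ℓ) : ∀ n, x n ∈ S ∩ edom f
  | 0 => h.start
  | n + 1 => by
    refine ⟨h.step_mem n, (hf.lt_top_iff _).2 ?_⟩
    -- The starting point gives the subproblem a finite value, so `fn` cannot be `⊤` at its
    -- minimiser.
    have h1 := h.step_argmin n (x 0) h.start.1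
    by_contra hne
    rw [not_lt_top_iff] at hne
    unfold subproblem at h1
    rw [hne, EReal.top_add_coe, top_le_iff,
      ← (hf.finiteAt_fn h.start.2).coe_toReal, ← EReal.coe_add] at h1
    exact EReal.coe_ne_top _ h1

/-- The optimality of the new iterate, tested at a feasible point and written in `ℝ`. -/
theorem IsEPSG.step_le (h : IsEPSG f fs fn g S ℓ β δ ζ μbar κbar x w τ κ μ)
    (hf : NumeratorAssumption f fs fn S ℓ) (n : ℕ) {y u v : H} (hy : y ∈ S ∩ edom f)
    (hu : u = x n + κ n • (x n - x (n - 1))) (hv : v = x n + μ n • (x n - x (n - 1))) :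
    (fn (x (n + 1))).toReal + inner ℝ (gradient fs u) (x (n + 1) - u)
        + 1 / (2 * τ n) * ‖x (n + 1) - v - (τ n * ratio f g (x n)) • w n‖ ^ 2
        + ℓ / 2 * ‖x (n + 1) - u‖ ^ 2 ≤
      (fn y).toReal + inner ℝ (gradient fs u) (y - u)
        + 1 / (2 * τ n) * ‖y - v - (τ n * ratio f g (x n)) • w n‖ ^ 2
        + ℓ / 2 * ‖y - u‖ ^ 2 := by
  have h1 := h.step_argmin n y hy.1
  rw [← hu, ← hv] at h1
  unfold subproblem at h1
  rw [← (hf.finiteAt_fn hy.2).coe_toReal,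
    ← (hf.finiteAt_fn (h.mem hf (n + 1)).2).coe_toReal] at h1
  have h2 : (fn (x (n + 1))).toReal + (fs u + inner ℝ (gradient fs u) (x (n + 1) - u)
        + 1 / (2 * τ n) * ‖x (n + 1) - v - (τ n * ratio f g (x n)) • w n‖ ^ 2
        + ℓ / 2 * ‖x (n + 1) - u‖ ^ 2) ≤
      (fn y).toReal + (fs u + inner ℝ (gradient fs u) (y - u)
        + 1 / (2 * τ n) * ‖y - v - (τ n * ratio f g (x n)) • w n‖ ^ 2
        + ℓ / 2 * ‖y - u‖ ^ 2) := by exact_mod_cast h1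
  linarith

theorem IsEPSG.numerator_le (h : IsEPSG f fs fn g S ℓ β δ ζ μbar κbar x w τ κ μ)
    (hf : NumeratorAssumption f fs fn S ℓ) (hg : DenominatorAssumption g S β)
    (hS : Convex ℝ S) (hδ : 0 < δ) (hζ : 0 < ζ) (hβζ : 0 < 1 - √β * ζ)
    (hw : ∀ n, HasGradientAt (fun z => (g z).toReal) (w n) (x n)) (n : ℕ) :
    (f (x (n + 1))).toReal ≤ ratio f g (x n) * (g (x (n + 1))).toReal
      + ℓ * κbar ^ 2 / 2 * ‖x n - x (n - 1)‖ ^ 2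
      + μbar * (‖x (n + 1) - x n‖ * ‖x n - x (n - 1)‖)
      - δ * (1 - √β * ζ) / 2 * ‖x (n + 1) - x n‖ ^ 2 := by
  have hmem := h.mem hf
  have hθ := ratio_nonneg hf hg (hmem n)
  set θ := ratio f g (x n) with hθdef
  set d := x n - x (n - 1) with hd
  set p := x (n + 1) - x n with hp
  have eu : x (n + 1) - (x n + κ n • d) = p - κ n • d := by rw [hp]; abel
  have ev : x (n + 1) - (x n + μ n • d) = p - μ n • d := by rw [hp]; abel
  have eu0 : x n - (x n + κ n • d) = -(κ n • d) := by abel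
  have ev0 : x n - (x n + μ n • d) = -(μ n • d) := by abel
  have hmin := h.step_le hf n (hmem n) rfl rfl
  have hconv := hf.gradient_le (x n + κ n • d) (x n)
  have hdesc := le_quadratic_of_lipschitz_gradient hf.differentiable hf.smooth_lipschitz
    (x n + κ n • d) (x (n + 1))
  rw [← hd, ← hθdef, eu, ev, eu0, ev0] at hmin
  rw [eu0] at hconv
  rw [eu] at hdesc
  have hgi := gradient_inequality (hg.convexOn hS) (hmem n).1 (hmem (n + 1)).1 (hw n)
  rw [hf.toReal_eq (hmem (n + 1)).2]
  refine numerator_step ℓ.2 (h.τ_pos n) (h.κ_mem n) (h.μ_mem n) hθ ?_ hmin hconv hdesc hgi ?_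
  · have hm : max (√β * θ / ζ) δ ≤ 1 / τ n := by
      have := h.τ_le n
      rwa [le_div_comm₀ (h.τ_pos n) (lt_max_of_lt_right hδ)] at this
    have h1 : √β * θ / ζ ≤ 1 / τ n := (le_max_left _ _).trans hm
    have h2 : δ ≤ 1 / τ n := (le_max_right _ _).trans hm
    rw [div_le_iff₀ hζ] at h1
    have h3 := mul_le_mul_of_nonneg_left h1 (Real.sqrt_nonneg β)
    have h4 := mul_le_mul_of_nonneg_right h2 hβζ.le
    have h5 : √β * (√β * θ) = β * θ := by
      rw [← mul_assoc, Real.mul_self_sqrt hg.modulus_nonneg]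
    linarith
  · rw [← hf.toReal_eq (hmem n).2, hθdef, ratio_mul hf hg (hmem n)]

/-- Successive iterates get arbitrarily close, and the objective values converge. -/
theorem IsEPSG.asymptotics [ProperSpace H]
    (h : IsEPSG f fs fn g S ℓ β δ ζ μbar κbar x w τ κ μ)
    (hf : NumeratorAssumption f fs fn S ℓ) (hg : DenominatorAssumption g S β)
    (hpar : Parameters f g S ℓ β δ ζ μbar κbar) (hScl : IsClosed S) (hS : Convex ℝ S)
    (hbdd : Bornology.IsBounded {y ∈ S | f y / g y ≤ f (x 0) / g (x 0)})
    (hw : ∀ n, HasGradientAt (fun z => (g z).toReal) (w n) (x n)) :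
    Tendsto (fun n => ‖x n - x (n - 1)‖) atTop (𝓝 0) ∧
      ∃ t, Tendsto (fun n => ratio f g (x n)) atTop (𝓝 t) := by
  have hmem := h.mem hf
  have hθ : ∀ n, 0 ≤ ratio f g (x n) := fun n => ratio_nonneg hf hg (hmem n)
  have hnum := h.numerator_le hf hg hS hpar.δ_pos hpar.ζ_pos hpar.ζ_small hw
  have hcpos : 0 < δ * (1 - √β * ζ) := mul_pos hpar.δ_pos hpar.ζ_small
  -- Truncated subtraction makes the initial step vanish.
  have hd0 : (fun n => ‖x n - x (n - 1)‖) 0 = 0 := by simp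
  rcases hpar.bounds with ⟨m, M, ⟨hm, hM, hmM⟩, hμ0, hμ, hκ0, hκ⟩ | ⟨hμ0, hκ0⟩
  · have hs : 0 < √(m * M) := Real.sqrt_pos.2 (mul_pos hm hM)
    have hgap := parameters_gap (c := δ * (1 - √β * ζ)) hm hM hμ hκ0
      (by simpa only [mul_assoc] using hκ)
    have hb : 0 ≤ (ℓ * κbar ^ 2 / m + μbar / √(m * M)) / 2 := by positivity
    refine (convergence_of_lyapunov hb hgap hθ hd0 fun n => ?_).2
    rw [ratio_eq hf hg (hmem (n + 1)), Nat.add_sub_cancel]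
    have hgb := hmM _ (hmem (n + 1))
    rw [← (hg.finiteAt (hmem (n + 1)).1).coe_toReal] at hgb
    refine ratio_step hm hM (by exact_mod_cast hgb.1) (by exact_mod_cast hgb.2) (by positivity)
      hμ0 ?_ (hnum n)
    linarith
  -- Without extrapolation the ratios decrease, so the iterates stay in the bounded level set. Its
  -- closure is compact and lies in `S`, where `g` is continuous; this supplies the missing upper
  -- bound `M`, and `b = 0` works.
  · have hstep : ∀ n, (f (x (n + 1))).toReal ≤ ratio f g (x n) * (g (x (n + 1))).toReal
        - δ * (1 - √β * ζ) / 2 * ‖x (n + 1) - x n‖ ^ 2 := fun n => by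
      simpa [hμ0, hκ0] using hnum n
    have hle : ∀ n, ratio f g (x n) ≤ ratio f g (x 0) := fun n => by
      refine antitone_nat_of_succ_le (f := fun n => ratio f g (x n)) (fun n => ?_) (Nat.zero_le n)
      rw [ratio_eq hf hg (hmem (n + 1)), div_le_iff₀ (hg.toReal_pos (hmem (n + 1)).1)]
      have : 0 ≤ δ * (1 - √β * ζ) / 2 * ‖x (n + 1) - x n‖ ^ 2 := by positivity
      linarith [hstep n]
    have hlevel : ∀ n, x n ∈ {y ∈ S | f y / g y ≤ f (x 0) / g (x 0)} := fun n => by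
      refine ⟨(hmem n).1, ?_⟩
      rw [ratio_eq_toReal_div hf hg (hmem n), ratio_eq_toReal_div hf hg (hmem 0),
        ← ratio_eq hf hg (hmem n), ← ratio_eq hf hg (hmem 0)]
      exact_mod_cast hle n
    have hcpt : IsCompact (closure {y ∈ S | f y / g y ≤ f (x 0) / g (x 0)}) :=
      hbdd.isCompact_closure
    have hsub : closure {y ∈ S | f y / g y ≤ f (x 0) / g (x 0)} ⊆ S :=
      hScl.closure_subset_iff.2 fun y hy => hy.1
    obtain ⟨O, -, hSO, hcont⟩ := hg.cont
    have hgc : ContinuousOn (fun z => (g z).toReal)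
        (closure {y ∈ S | f y / g y ≤ f (x 0) / g (x 0)}) := by
      refine EReal.continuousOn_toReal.comp (hcont.mono (hsub.trans hSO)) fun z hz => ?_
      have := hg.finiteAt (hsub hz)
      simp [this.1, this.2]
    obtain ⟨M, hM⟩ := hcpt.bddAbove_image hgc
    have hgM : ∀ n, (g (x n)).toReal ≤ M := fun n =>
      hM (mem_image_of_mem _ (subset_closure (hlevel n)))
    have hMpos : 0 < M := (hg.toReal_pos (hmem 0).1).trans_le (hgM 0)
    refine (convergence_of_lyapunov (a := δ * (1 - √β * ζ) / 2 / M) le_rfl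
      (by positivity) hθ hd0 fun n => ?_).2
    have hgpos := hg.toReal_pos (hmem (n + 1)).1
    rw [ratio_eq hf hg (hmem (n + 1)), Nat.add_sub_cancel, zero_mul, add_zero]
    have hq : 0 ≤ δ * (1 - √β * ζ) / 2 / M * ‖x (n + 1) - x n‖ ^ 2 := by positivity
    have h1 := mul_le_mul_of_nonneg_right (hgM (n + 1)) hq
    have e1 : M * (δ * (1 - √β * ζ) / 2 / M * ‖x (n + 1) - x n‖ ^ 2)
        = δ * (1 - √β * ζ) / 2 * ‖x (n + 1) - x n‖ ^ 2 := by field_simp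
    have h2 := hstep n
    have h3 : (f (x (n + 1))).toReal ≤ (ratio f g (x n)
        - δ * (1 - √β * ζ) / 2 / M * ‖x (n + 1) - x n‖ ^ 2) * (g (x (n + 1))).toReal := by
      linarith
    have h4 := (div_le_iff₀ hgpos).2 h3
    linarith

end

/-! ### Subgradients at the iterates and passage to the limit. -/

section

variable {H : Type*} [NormedAddCommGroup H] [InnerProductSpace ℝ H]
variable [CompleteSpace H] {f fn g : H → EReal} {fs : H → ℝ} {S : Set H} {ℓ : ℝ≥0}
  {β δ ζ μbar κbar : ℝ} {x w : ℕ → H} {τ κ μ : ℕ → ℝ}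

/-- The optimality of the new iterate as a quadratic minorant of `fn` on the feasible set. -/
theorem IsEPSG.quadratic_minorant (h : IsEPSG f fs fn g S ℓ β δ ζ μbar κbar x w τ κ μ)
    (hf : NumeratorAssumption f fs fn S ℓ) (n : ℕ) {z u v a : H} (hz : z ∈ S ∩ edom f)
    (hu : u = x n + κ n • (x n - x (n - 1))) (hv : v = x n + μ n • (x n - x (n - 1)))
    (ha : a = gradient fs u + (τ n)⁻¹ • (x (n + 1) - v) - ratio f g (x n) • w n
      + (ℓ : ℝ) • (x (n + 1) - u)) :
    (fn (x (n + 1))).toReal - inner ℝ a (z - x (n + 1))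
      - ((τ n)⁻¹ / 2 + ℓ / 2) * ‖z - x (n + 1)‖ ^ 2 ≤ (fn z).toReal := by
  have h1 := h.step_le hf n hz hu hv
  have hτ := h.τ_pos n
  set y := x (n + 1)
  set θ := ratio f g (x n)
  -- The smooth part of the subproblem is quadratic, so its expansion at the new iterate is exact:
  -- `a` is its gradient there and the remainder is `(1/τ + ℓ)/2` times the squared distance.
  have e1 : inner ℝ (gradient fs u) (z - u)
      = inner ℝ (gradient fs u) (y - u) + inner ℝ (gradient fs u) (z - y) := by
    rw [← inner_add_right]
    congr 1
    abel
  have e2 : ‖z - v - (τ n * θ) • w n‖ ^ 2 = ‖y - v - (τ n * θ) • w n‖ ^ 2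
      + 2 * inner ℝ (y - v - (τ n * θ) • w n) (z - y) + ‖z - y‖ ^ 2 := by
    rw [← norm_add_sq_real]
    congr 2
    abel
  have e3 : ‖z - u‖ ^ 2 = ‖y - u‖ ^ 2 + 2 * inner ℝ (y - u) (z - y) + ‖z - y‖ ^ 2 := by
    rw [← norm_add_sq_real]
    congr 2
    abel
  have e4 : inner ℝ a (z - y) = inner ℝ (gradient fs u) (z - y)
      + 1 / (2 * τ n) * (2 * inner ℝ (y - v - (τ n * θ) • w n) (z - y))
      + ℓ * inner ℝ (y - u) (z - y) := by
    rw [ha, inner_add_left, inner_sub_left, inner_add_left, real_inner_smul_left,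
      real_inner_smul_left, real_inner_smul_left, inner_sub_left (y - v), real_inner_smul_left]
    field_simp
    ring
  have e5 : (τ n)⁻¹ / 2 = 1 / (2 * τ n) := by field_simp
  rw [e1, e2, e3] at h1
  rw [e4, e5]
  linarith

/-- Fermat's rule for the subproblem: adding `fs` to the quadratic minorant of `fn` gives one for `f
+ ι_S`. -/
theorem IsEPSG.subgradient_mem (h : IsEPSG f fs fn g S ℓ β δ ζ μbar κbar x w τ κ μ)
    (hf : NumeratorAssumption f fs fn S ℓ) (n : ℕ) {u v a : H}
    (hu : u = x n + κ n • (x n - x (n - 1))) (hv : v = x n + μ n • (x n - x (n - 1)))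
    (ha : a = gradient fs u + (τ n)⁻¹ • (x (n + 1) - v) - ratio f g (x n) • w n
      + (ℓ : ℝ) • (x (n + 1) - u)) :
    gradient fs (x (n + 1)) - a ∈ frechetSubdiff (addIndicator f S) (x (n + 1)) := by
  have hmem := h.mem hf (n + 1)
  have hval : addIndicator f S (x (n + 1)) = f (x (n + 1)) := by simp [addIndicator, hmem.1]
  refine sub_mem_frechetSubdiff_of_minorant (K := (τ n)⁻¹ / 2 + ℓ / 2) ?_
    (hf.differentiable _).hasGradientAt fun z => ?_
  · unfold FiniteAt
    rw [hval]
    exact hf.finiteAt hmem.2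
  rw [hval]
  by_cases hz : z ∈ S ∩ edom f
  · have h1 := h.quadratic_minorant hf n hz hu hv ha
    simp only [addIndicator, hz.1, if_true]
    rw [← (hf.finiteAt hz.2).coe_toReal, hf.toReal_eq hz.2, hf.toReal_eq hmem.2]
    refine EReal.coe_le_coe_iff.2 ?_
    linarith
  · have : addIndicator f S z = ⊤ := by
      by_cases hzS : z ∈ S
      · simp only [addIndicator, hzS, if_true]
        exact not_lt_top_iff.1 fun hlt => hz ⟨hzS, hlt⟩
      · simp [addIndicator, hzS]
    rw [this]
    exact le_top

theorem exists_eventually_inv_le {τ : ℕ → ℝ} (hpos : ∀ n, 0 < τ n) (hτ : 0 < liminf τ atTop) :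
    ∃ K, ∀ᶠ n in atTop, (τ n)⁻¹ ≤ K := by
  obtain ⟨c, hc0, hc⟩ := exists_between hτ
  refine ⟨c⁻¹, ?_⟩
  have hb : IsBoundedUnder (· ≥ ·) atTop τ := isBoundedUnder_of ⟨0, fun n => (hpos n).le⟩
  filter_upwards [eventually_lt_of_lt_liminf hc hb] with n hn
  exact inv_anti₀ hc0 hn.le

theorem tendsto_smul_zero_of_bounded {E ι : Type*} [NormedAddCommGroup E] [NormedSpace ℝ E]
    {l : Filter ι} {s : ι → ℝ} {v : ι → E} {K : ℝ} (hs : ∀ᶠ i in l, |s i| ≤ K)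
    (hv : Tendsto v l (𝓝 0)) : Tendsto (fun i => s i • v i) l (𝓝 0) := by
  refine squeeze_zero_norm' (a := fun i => K * ‖v i‖) ?_ ?_
  · filter_upwards [hs] with i hi
    rw [norm_smul]
    exact mul_le_mul_of_nonneg_right hi (norm_nonneg _)
  · simpa using hv.norm.const_mul K

theorem IsEPSG.isStationary [ProperSpace H]
    (h : IsEPSG f fs fn g S ℓ β δ ζ μbar κbar x w τ κ μ)
    (hf : NumeratorAssumption f fs fn S ℓ) (hg : DenominatorAssumption g S β)
    (hpar : Parameters f g S ℓ β δ ζ μbar κbar) (hScl : IsClosed S) (hS : Convex ℝ S)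
    (hbdd : Bornology.IsBounded {y ∈ S | f y / g y ≤ f (x 0) / g (x 0)})
    (hτ : 0 < liminf τ atTop) {U : Set H} (hU : IsOpen U) (hSU : S ∩ edom f ⊆ U)
    (hgU : ∀ y ∈ U, StrictDiffAt g y) {xbar : H} (hx : MapClusterPt xbar atTop x) :
    IsStationary f g S xbar := by
  have hmem := h.mem hf
  set G : H → ℝ := fun z => (g z).toReal with hGdef
  have hwgrad : ∀ n, w n = gradient G (x n) := fun n =>
    eq_gradient_of_mem_limitingSubdiff hU hgU (hSU (hmem n)) (h.subgrad n)
  have hw : ∀ n, HasGradientAt G (w n) (x n) := fun n => by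
    rw [hwgrad]
    exact (hgU _ (hSU (hmem n))).hasGradientAt
  obtain ⟨hd, t, ht⟩ := h.asymptotics hf hg hpar hScl hS hbdd hw
  obtain ⟨φ, hφ, hxφ⟩ := hx.tendsto_subseq
  have hφt := hφ.tendsto_atTop
  have hφ1 : Tendsto (fun k => φ k + 1) atTop atTop := (tendsto_add_atTop_nat 1).comp hφt
  have hxφ : Tendsto (fun k => x (φ k)) atTop (𝓝 xbar) := hxφ
  have hθ0 : Tendsto (fun k => ratio f g (x (φ k))) atTop (𝓝 t) := ht.comp hφt
  have hθ1 : Tendsto (fun k => ratio f g (x (φ k + 1))) atTop (𝓝 t) := ht.comp hφ1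
  have hd0 : Tendsto (fun k => x (φ k) - x (φ k - 1)) atTop (𝓝 0) :=
    tendsto_zero_iff_norm_tendsto_zero.2 (hd.comp hφt)
  have hd1 : Tendsto (fun k => x (φ k + 1) - x (φ k)) atTop (𝓝 0) :=
    tendsto_zero_iff_norm_tendsto_zero.2 (by simpa [Function.comp_def] using hd.comp hφ1)
  have hy : Tendsto (fun k => x (φ k + 1)) atTop (𝓝 xbar) := by
    simpa using hxφ.add hd1
  have hu : Tendsto (fun k => x (φ k) + κ (φ k) • (x (φ k) - x (φ k - 1))) atTop (𝓝 xbar) := by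
    have := hxφ.add (tendsto_smul_zero_of_bounded (s := fun k => κ (φ k)) (K := κbar)
      (Eventually.of_forall fun k => by
        rw [abs_of_nonneg (h.κ_mem _).1]
        exact (h.κ_mem _).2) hd0)
    simpa using this
  have hτle : ∀ n, τ n ≤ 1 / δ := fun n =>
    (h.τ_le n).trans (one_div_le_one_div_of_le hpar.δ_pos (le_max_right _ _))
  have hv : Tendsto (fun k => x (φ k) + μ (φ k) • (x (φ k) - x (φ k - 1))) atTop (𝓝 xbar) := by
    have := hxφ.add (tendsto_smul_zero_of_bounded (s := fun k => μ (φ k)) (K := μbar * (1 / δ))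
      (Eventually.of_forall fun k => by
        have hμ := h.μ_mem (φ k)
        rw [abs_of_nonneg hμ.1]
        have hμbar : 0 ≤ μbar := nonneg_of_mul_nonneg_left (hμ.1.trans hμ.2) (h.τ_pos _)
        exact hμ.2.trans (mul_le_mul_of_nonneg_left (hτle _) hμbar)) hd0)
    simpa using this
  obtain ⟨K, hK⟩ := exists_eventually_inv_le h.τ_pos hτ
  have hKφ : ∀ᶠ k in atTop, |(τ (φ k))⁻¹| ≤ K := by
    filter_upwards [hφt.eventually hK] with k hk
    rwa [abs_of_pos (inv_pos.2 (h.τ_pos _))]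
  have hxS : xbar ∈ S := hScl.mem_of_tendsto hxφ (Eventually.of_forall fun k => (hmem _).1)
  have hgfin := hg.finiteAt hxS
  have hGpos : 0 < G xbar := hg.toReal_pos hxS
  -- It is not yet known that `xbar` lies in `dom f`, hence in `U`, so continuity comes from the
  -- assumption on `g` near `S`.
  have hGc : ContinuousAt G xbar := by
    obtain ⟨O, hO, hSO, hcont⟩ := hg.cont
    exact (EReal.tendsto_toReal hgfin.2 hgfin.1).comp
      (hcont.continuousAt (hO.mem_nhds (hSO hxS)))
  have hGy : Tendsto (fun k => G (x (φ k + 1))) atTop (𝓝 (G xbar)) := hGc.tendsto.comp hy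
  have hFy : Tendsto (fun k => (f (x (φ k + 1))).toReal) atTop (𝓝 (t * G xbar)) :=
    (hθ1.mul hGy).congr fun k => ratio_mul hf hg (hmem _)
  have hfsc : Continuous fs := hf.differentiable.continuous
  have hny : Tendsto (fun k => (fn (x (φ k + 1))).toReal) atTop
      (𝓝 (t * G xbar - fs xbar)) :=
    (hFy.sub ((hfsc.tendsto xbar).comp hy)).congr fun k => by
      rw [hf.toReal_eq (hmem _).2]
      simp
  have hfn_le : fn xbar ≤ ((t * G xbar - fs xbar : ℝ) : EReal) := by
    by_contra hlt
    obtain ⟨c, hc1, hc2⟩ := EReal.lt_iff_exists_real_btwn.1 (not_le.1 hlt)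
    have h1 : ∀ᶠ k in atTop, c ≤ (fn (x (φ k + 1))).toReal := by
      filter_upwards [hy.eventually (hf.fn_lsc xbar c hc2)] with k hk
      rw [← (hf.finiteAt_fn (hmem (φ k + 1)).2).coe_toReal] at hk
      exact_mod_cast hk.le
    have h2 := ge_of_tendsto hny h1
    have h3 : t * G xbar - fs xbar < c := by exact_mod_cast hc1
    linarith
  have hxf : xbar ∈ S ∩ edom f :=
    ⟨hxS, (hf.lt_top_iff _).2 (hfn_le.trans_lt (EReal.coe_lt_top _))⟩
  have hwlim : Tendsto (fun k => w (φ k)) atTop (𝓝 (gradient G xbar)) :=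
    (tendsto_gradient_of_strictDiffAt hU hgU (hSU hxf) hxφ).congr fun k => (hwgrad _).symm
  have hgylim : Tendsto (fun k => gradient G (x (φ k + 1))) atTop (𝓝 (gradient G xbar)) :=
    tendsto_gradient_of_strictDiffAt hU hgU (hSU hxf) hy
  have hgfc : Continuous (gradient fs) := hf.smooth_lipschitz.continuous
  set a : ℕ → H := fun k => gradient fs (x (φ k) + κ (φ k) • (x (φ k) - x (φ k - 1)))
    + (τ (φ k))⁻¹ • (x (φ k + 1) - (x (φ k) + μ (φ k) • (x (φ k) - x (φ k - 1))))
    - ratio f g (x (φ k)) • w (φ k)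
    + (ℓ : ℝ) • (x (φ k + 1) - (x (φ k) + κ (φ k) • (x (φ k) - x (φ k - 1)))) with ha
  have halim : Tendsto a atTop (𝓝 (gradient fs xbar - t • gradient G xbar)) := by
    have h1 : Tendsto (fun k => (τ (φ k))⁻¹ •
        (x (φ k + 1) - (x (φ k) + μ (φ k) • (x (φ k) - x (φ k - 1))))) atTop (𝓝 0) :=
      tendsto_smul_zero_of_bounded hKφ (by simpa using hy.sub hv)
    have h2 := ((((hgfc.tendsto xbar).comp hu).add h1).sub (hθ0.smul hwlim)).add
      ((hy.sub hu).const_smul (ℓ : ℝ))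
    simpa using h2
  -- Lower semicontinuity gives `≤`. For `≥`, the quadratic minorants are tested at `xbar`: `a k`
  -- converges and `1/τ` stays bounded, so the correction terms vanish.
  have hn_eq : (fn xbar).toReal = t * G xbar - fs xbar := by
    refine le_antisymm ?_ ?_
    · rw [← (hf.finiteAt_fn hxf.2).coe_toReal] at hfn_le
      exact_mod_cast hfn_le
    · have hzy : Tendsto (fun k => xbar - x (φ k + 1)) atTop (𝓝 0) := by
        simpa using hy.const_sub xbar
      have hsq : Tendsto (fun k => ((τ (φ k))⁻¹ / 2 + ℓ / 2) • ‖xbar - x (φ k + 1)‖ ^ 2) atTop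
          (𝓝 0) := by
        refine tendsto_smul_zero_of_bounded (K := K / 2 + ℓ / 2) ?_ (by simpa using hzy.norm.pow 2)
        filter_upwards [hKφ] with k hk
        have := inv_pos.2 (h.τ_pos (φ k))
        rw [abs_of_pos this] at hk
        rw [abs_of_nonneg (by positivity)]
        linarith
      have hlim := (hny.sub (halim.inner hzy)).sub hsq
      rw [inner_zero_right, sub_zero, sub_zero] at hlim
      exact le_of_tendsto hlim (Eventually.of_forall fun k =>
        h.quadratic_minorant hf (φ k) hxf rfl rfl rfl)
  have hFx : (f xbar).toReal = t * G xbar := by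
    rw [hf.toReal_eq hxf.2, hn_eq]
    ring
  have hratio : ratio f g xbar = t := by
    rw [ratio_eq hf hg hxf, hFx]
    exact mul_div_cancel_right₀ _ hGpos.ne'
  have hval : ∀ z ∈ S ∩ edom f,
      addIndicator (fun z => f z / g z) S z = ((ratio f g z : ℝ) : EReal) := fun z hz => by
    simp only [addIndicator, hz.1, if_true]
    rw [ratio_eq_toReal_div hf hg hz, ratio_eq hf hg hz]
  refine ⟨hxS, ?_, fun k => x (φ k + 1), fun k => (G (x (φ k + 1)) ^ 2)⁻¹ •
    (G (x (φ k + 1)) • (gradient fs (x (φ k + 1)) - a k)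
      - (f (x (φ k + 1))).toReal • gradient G (x (φ k + 1))), hy, ?_, ?_, fun k => ?_⟩
  · unfold FiniteAt
    rw [hval _ hxf]
    exact ⟨EReal.coe_ne_bot _, EReal.coe_ne_top _⟩
  · rw [hval _ hxf, hratio]
    exact ((continuous_coe_real_ereal.tendsto t).comp hθ1).congr fun k => (hval _ (hmem _)).symm
  · have h1 := ((hGy.pow 2).inv₀ (by positivity)).smul
      ((hGy.smul (((hgfc.tendsto xbar).comp hy).sub halim)).sub (hFy.smul hgylim))
    -- The numerator subgradients tend to `t ∇g` and `f` to `t g(xbar)`, so the two terms of the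
    -- quotient rule cancel.
    have e : (G xbar ^ 2)⁻¹ • (G xbar • (gradient fs xbar
        - (gradient fs xbar - t • gradient G xbar)) - (t * G xbar) • gradient G xbar) = 0 := by
      rw [sub_sub_cancel, smul_smul, mul_comm, sub_self, smul_zero]
    rw [e] at h1
    exact h1
  · exact frechetSubdiff_div hg.finite_pos hf.ne_bot (hmem _).1 (hf.toReal_nonneg (hmem _))
      (hgU _ (hSU (hmem _))).hasGradientAt (h.subgradient_mem hf (φ k) rfl rfl rfl)

end

end FracProg

theorem corollary4p2 {H : Type*} [NormedAddCommGroup H] [InnerProductSpace ℝ H]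
    [FiniteDimensional ℝ H] [CompleteSpace H]
    (S : Set H) (hSne : S.Nonempty) (hScl : IsClosed S) (hScv : Convex ℝ S)
    (f fn fl g : H → EReal) (fs : H → ℝ) (C : Set H) (ℓ : ℝ≥0) (β δ ζ μbar κbar : ℝ)
    (hf : FracProg.NumeratorAssumption f fs fn S ℓ)
    (hg : FracProg.DenominatorAssumption g S β)
    (hpar : FracProg.Parameters f g S ℓ β δ ζ μbar κbar)
    (x w : ℕ → H) (τ κ μ : ℕ → ℝ)
    (halg : FracProg.IsEPSG f fs fn g S ℓ β δ ζ μbar κbar x w τ κ μ)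
    (hbdd : Bornology.IsBounded {y ∈ S | f y / g y ≤ f (x 0) / g (x 0)})
    (hτ : 0 < liminf τ atTop)
    (hstruct : FracProg.StructureAssumption f fn fl g S C)
    (hgdiff : ∃ U : Set H, IsOpen U ∧ S ∩ FracProg.edom f ⊆ U ∧
      ∀ y ∈ U, FracProg.StrictDiffAt g y)
    (xbar : H) (hx : MapClusterPt xbar atTop x) :
    FracProg.IsStationary f g S xbar := by
  obtain ⟨U, hU, hSU, hgU⟩ := hgdiff
  have : ProperSpace H := FiniteDimensional.proper_real H
  exact halg.isStationary hf hg hpar hScl hScv hbdd hτ hU hSU hgU hx
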